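/- A \emph{metric tree} ($\mathbb{R}$-tree) is a non-empty metric space in which any two points are joined by a unique geodesic segment, and in which, whenever two geodesic segments $[y,x]$ and $[x,z]$ satisfy $[y,x]\cap[x,z]=\{x\}$, their union is a geodesic segment $[y,z]$. A group $G$ has \emph{property $\mathrm{F}\mathcal{R}$} if every action of $G$ by isometries on a metric tree has a global fixed point. Let $\Gamma=(V,E)$ be a finite simplicial graph. (i) Let $(G_v)_{v\in V}$ be a family of non-trivial finite groups, and let $$G_\Gamma=\Big(\mathop{*}_{v\in V}G_v\Big)\Big/\big\langle\big\langle\, gh=hg \mid g\in G_v,\ h\in G_w,\ \{v,w\}\in E\,\big\rangle\big\rangle$$ be their graph product. Then $G_\Gamma$ has property $\mathrm{F}\mathcal{R}$ if and only if $\Gamma$ is a complete graph. (ii) Let $\varphi:E\to\mathbb{N}_{\geq 2}$ be an edge-labelling, and let $$W_\Gamma=\big\langle V \mid v^2,\ (vw)^{\varphi(\{v,w\})},\ v\in V,\ \{v,w\}\in E\big\rangle$$ be the corresponding Coxeter group. Then $W_\Gamma$ has property $\mathrm{F}\mathcal{R}$ if and only if $\Gamma$ is a complete graph. -/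

import Mathlib

universe u v w

/-- `S` is a geodesic segment from `x` to `y`: the image of an isometric embedding
of the interval `[0, dist x y]` that starts at `x` and ends at `y`. -/
def IsGeodesicSegment {X : Type w} [MetricSpace X] (x y : X) (S : Set X) : Prop :=
  ∃ γ : ℝ → X, γ 0 = x ∧ γ (dist x y) = y ∧
    (∀ s ∈ Set.Icc 0 (dist x y), ∀ t ∈ Set.Icc 0 (dist x y), dist (γ s) (γ t) = |s - t|) ∧
    S = γ '' Set.Icc 0 (dist x y)

/-- A metric tree (`ℝ`-tree): a nonempty metric space in which any two points are joined by
a unique geodesic segment, and in which two geodesic segments `[y, x]` and `[x, z]` that meet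
only in `x` form together a geodesic segment `[y, z]`. -/
structure IsRTree (X : Type w) [MetricSpace X] : Prop where
  nonempty : Nonempty X
  existsUnique_segment : ∀ x y : X, ∃! S : Set X, IsGeodesicSegment x y S
  union_segment : ∀ (x y z : X) (S T : Set X), IsGeodesicSegment y x S →
    IsGeodesicSegment x z T → S ∩ T = {x} → IsGeodesicSegment y z (S ∪ T)

/-- Property `Fℝ`: every action by isometries on a metric tree has a global fixed point. -/
def HasPropertyFR.{a, b} (G : Type b) [Group G] : Prop :=
  ∀ (X : Type a) [MetricSpace X] [MulAction G X] [IsIsometricSMul G X],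
    IsRTree X → ∃ x : X, ∀ g : G, g • x = x

/-- The commutators `g h g⁻¹ h⁻¹` in the free product of the vertex groups, where `g` and `h` belong
to the vertex groups of two adjacent vertices. -/
def graphProductRelators {V : Type u} (Γ : SimpleGraph V) (G : V → Type v)
    [∀ i, Group (G i)] : Set (Monoid.CoprodI G) :=
  {x | ∃ i j : V, Γ.Adj i j ∧ ∃ (g : G i) (h : G j),
    x = Monoid.CoprodI.of g * Monoid.CoprodI.of h *
      (Monoid.CoprodI.of g)⁻¹ * (Monoid.CoprodI.of h)⁻¹}

/-- The graph product of the groups `G i` over the graph `Γ`: the free product of the vertex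
groups, modulo the relations `g h = h g` for `g`, `h` in adjacent vertex groups. -/
abbrev GraphProduct {V : Type u} (Γ : SimpleGraph V) (G : V → Type v)
    [∀ i, Group (G i)] : Type (max u v) :=
  Monoid.CoprodI G ⧸ Subgroup.normalClosure (graphProductRelators Γ G)

open Classical in
/-- The Coxeter matrix of a simplicial graph whose edges are labelled by integers `≥ 2`: the entry
at an edge is its label, and the entry at two distinct non-adjacent vertices is `0`, which is
Mathlib's encoding of `∞` (no relation). -/
noncomputable def labelledCoxeterMatrix {V : Type u} (Γ : SimpleGraph V) (φ : Γ.edgeSet → ℕ)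
    (hφ : ∀ e, 2 ≤ φ e) : CoxeterMatrix V where
  M := Matrix.of fun i j =>
    if i = j then 1
    else if h : Γ.Adj i j then φ ⟨s(i, j), Γ.mem_edgeSet.mpr h⟩ else 0
  isSymm := by
    ext i j
    simp only [Matrix.transpose_apply, Matrix.of_apply, Sym2.eq_swap (a := i) (b := j),
      Γ.adj_comm i j, eq_comm (a := i) (b := j)]
  diagonal i := by simp
  off_diagonal i j hij := by
    simp only [Matrix.of_apply, if_neg hij]
    split_ifs with h
    · have := hφ ⟨s(i, j), Γ.mem_edgeSet.mpr h⟩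
      omega
    · omega

/-- The Coxeter group `W_Γ = ⟨V ∣ v², (v w)^φ({v, w}), v ∈ V, {v, w} ∈ E⟩`. -/
abbrev GraphCoxeterGroup {V : Type u} (Γ : SimpleGraph V) (φ : Γ.edgeSet → ℕ)
    (hφ : ∀ e, 2 ≤ φ e) : Type u :=
  (labelledCoxeterMatrix Γ φ hφ).Group

/-! In a metric tree the fixed points of a set of isometries form a convex set. By Helly's theorem
(`IsRTree.helly`), a group generated by finitely many subsets fixes a point as soon as any two of
the subsets have a common fixed point (`hasPropertyFR_of_pairwise`). Over a complete graph these are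
two commuting finite groups, or two involutions whose product has finite order; the midpoint of
suitable orbit points is fixed by both.

Conversely, let `v ≠ w` be non-adjacent. The group maps to a concrete group: the direct product of
the vertex groups, or the linear group of the geometric representation. In it, take the two
subgroups that are trivial at, respectively preserve, the coordinate `v` or `w`. The generators in
each defining relation lie together in one of these subgroups, so the group also maps to their
amalgam over the intersection. The generators at `v` and `w` go to different factors, outside the
base, so the powers of their product have unbounded word length. Injectivity of the map plays no
role.

Word length in an amalgam satisfies the four-point condition, because the overlap of normal forms
obeys an ultrametric inequality. An invariant four-point pseudometric comes from an action on a
metric tree (`InvariantTreeMetric.Tree`), and an unbounded orbit excludes a fixed point. -/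

/-! ### Geodesic segments, betweenness and medians in metric trees. -/

section GeodesicSegments

variable {X : Type*} [MetricSpace X] {x y z p q : X} {S T : Set X}

lemma IsGeodesicSegment.symm (h : IsGeodesicSegment x y S) : IsGeodesicSegment y x S := by
  obtain ⟨γ, h0, h1, hγ, rfl⟩ := h
  have hd := dist_comm x y
  refine ⟨fun t => γ (dist x y - t), by simpa using h1, by simp [← hd, h0], ?_, ?_⟩
  · intro s hs t ht
    rw [← hd] at hs ht
    rw [hγ _ ⟨by linarith [hs.2], by linarith [hs.1]⟩ _ ⟨by linarith [ht.2], by linarith [ht.1]⟩,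
      abs_sub_comm]
    congr 1
    ring
  · ext q
    constructor
    · rintro ⟨t, ht, rfl⟩
      exact ⟨dist x y - t, ⟨by linarith [ht.2], by linarith [ht.1]⟩, by simp⟩
    · rintro ⟨t, ht, rfl⟩
      rw [← hd] at ht
      exact ⟨dist x y - t, ⟨by linarith [ht.2], by linarith [ht.1]⟩, rfl⟩

lemma IsGeodesicSegment.dist_add_dist (h : IsGeodesicSegment x y S) (hp : p ∈ S) :
    dist x p + dist p y = dist x y := by
  obtain ⟨γ, h0, h1, hγ, rfl⟩ := h
  obtain ⟨t, ht, rfl⟩ := hp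
  have hd : (0 : ℝ) ≤ dist x y := dist_nonneg
  have e1 := hγ 0 ⟨le_rfl, hd⟩ t ht
  have e2 := hγ t ht (dist x y) ⟨hd, le_rfl⟩
  rw [h0, zero_sub, abs_neg, abs_of_nonneg ht.1] at e1
  rw [h1, abs_sub_comm, abs_of_nonneg (by linarith [ht.2])] at e2
  linarith

lemma IsGeodesicSegment.left_mem (h : IsGeodesicSegment x y S) : x ∈ S := by
  obtain ⟨γ, h0, h1, hγ, rfl⟩ := h
  exact ⟨0, ⟨le_rfl, dist_nonneg⟩, h0⟩

lemma IsGeodesicSegment.right_mem (h : IsGeodesicSegment x y S) : y ∈ S :=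
  h.symm.left_mem

lemma IsGeodesicSegment.exists_point (h : IsGeodesicSegment x y S) {r : ℝ} (h0 : 0 ≤ r)
    (h1 : r ≤ dist x y) : ∃ p ∈ S, dist x p = r ∧ dist p y = dist x y - r := by
  have h' := h
  obtain ⟨γ, g0, g1, hγ, rfl⟩ := h
  have e1 := hγ 0 ⟨le_rfl, dist_nonneg⟩ r ⟨h0, h1⟩
  rw [g0, zero_sub, abs_neg, abs_of_nonneg h0] at e1
  have hm : γ r ∈ γ '' Set.Icc 0 (dist x y) := ⟨r, ⟨h0, h1⟩, rfl⟩
  exact ⟨γ r, hm, e1, by linarith [h'.dist_add_dist hm]⟩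

/-- The initial part of a geodesic segment that ends at the point `q`. -/
lemma IsGeodesicSegment.exists_initial (h : IsGeodesicSegment x y S) (hq : q ∈ S) :
    ∃ T ⊆ S, IsGeodesicSegment x q T ∧ ∀ s ∈ S, dist x s ≤ dist x q → s ∈ T := by
  obtain ⟨γ, h0, h1, hγ, rfl⟩ := h
  obtain ⟨t, ht, rfl⟩ := hq
  have key : ∀ s ∈ Set.Icc 0 (dist x y), dist x (γ s) = s := by
    intro s hs
    have e1 := hγ 0 ⟨le_rfl, dist_nonneg⟩ s hs
    rwa [h0, zero_sub, abs_neg, abs_of_nonneg hs.1] at e1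
  have hsub : Set.Icc 0 t ⊆ Set.Icc 0 (dist x y) := Set.Icc_subset_Icc_right ht.2
  refine ⟨γ '' Set.Icc 0 t, Set.image_mono hsub, ⟨γ, h0, ?_, ?_, ?_⟩, ?_⟩
  · rw [key t ht]
  · intro s hs r hr
    rw [key t ht] at hs hr
    exact hγ s (hsub hs) r (hsub hr)
  · rw [key t ht]
  · rintro _ ⟨s, hs, rfl⟩ hle
    rw [key s hs, key t ht] at hle
    exact ⟨s, ⟨hs.1, hle⟩, rfl⟩

end GeodesicSegments

namespace IsRTree

variable {X : Type*} [MetricSpace X] (hX : IsRTree X)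
include hX

/-- Tripod property: the branch towards `z` can leave `p` along at most one of the two directions to
`x` and `y`. The later fixed-point arguments use uniqueness of segments and the union axiom only
through it. -/
lemma dist_add_dist_or {x y p : X} (hp : dist x p + dist p y = dist x y) (z : X) :
    dist x p + dist p z = dist x z ∨ dist y p + dist p z = dist y z := by
  obtain ⟨S₁, hS₁, -⟩ := hX.existsUnique_segment x p
  obtain ⟨S₂, hS₂, -⟩ := hX.existsUnique_segment y p
  obtain ⟨T, hT, -⟩ := hX.existsUnique_segment p z
  by_cases h1 : S₁ ∩ T = {p}
  · exact .inl ((hX.union_segment p x z S₁ T hS₁ hT h1).dist_add_dist (.inl hS₁.right_mem))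
  by_cases h2 : S₂ ∩ T = {p}
  · exact .inr ((hX.union_segment p y z S₂ T hS₂ hT h2).dist_add_dist (.inl hS₂.right_mem))
  exfalso
  have hex : ∀ {S : Set X}, p ∈ S → S ∩ T ≠ {p} → ∃ q ∈ S ∩ T, q ≠ p := by
    intro S hpS hne
    by_contra! hcon
    exact hne (Set.eq_singleton_iff_unique_mem.2 ⟨⟨hpS, hT.left_mem⟩, hcon⟩)
  obtain ⟨q, ⟨hq1, hqT⟩, hq⟩ := hex hS₁.right_mem h1
  obtain ⟨q', ⟨hq1', hqT'⟩, hq'⟩ := hex hS₂.right_mem h2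
  have hinter : ∀ r ∈ S₁, r ∈ S₂ → r = p := by
    intro r hr1 hr2
    have e1 := hS₁.dist_add_dist hr1
    have e2 := hS₂.dist_add_dist hr2
    have e3 := dist_triangle x r y
    rw [dist_comm y r, dist_comm y p] at e2
    exact dist_le_zero.1 (by linarith)
  -- By uniqueness of the segment `[p, r]`, both segments agree up to `r`. So the one of `q`, `q'`
  -- nearer to `p` lies on `S₁` and on `S₂`, which meet only in `p`.
  have hmove : ∀ {a : X} {S : Set X}, IsGeodesicSegment a p S → ∀ {r s : X}, r ∈ S → r ∈ T →
      s ∈ T → dist p s ≤ dist p r → s ∈ S := by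
    intro a S hS r s hrS hrT hsT hle
    obtain ⟨T', hT', hT's, hT'm⟩ := hT.exists_initial hrT
    obtain ⟨S', hS', hS's, -⟩ := hS.symm.exists_initial hrS
    rw [(hX.existsUnique_segment p r).unique hT's hS's] at hT'm
    exact hS' (hT'm s hsT hle)
  rcases le_total (dist p q') (dist p q) with hle | hle
  · exact hq' (hinter q' (hmove hS₁ hq1 hqT hqT' hle) hq1')
  · exact hq (hinter q hq1 (hmove hS₂ hq1' hqT' hqT hle))

/-- An isometry that fixes or swaps the ends of a segment preserves the distances of its midpoint to
them; this lemma then shows that the midpoint is fixed. -/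
lemma eq_of_dist_eq {x y p q : X} (hp : dist x p + dist p y = dist x y)
    (h1 : dist x q = dist x p) (h2 : dist q y = dist p y) : q = p := by
  rw [← dist_le_zero, dist_comm]
  rcases hX.dist_add_dist_or hp q with h | h
  · linarith
  · rw [dist_comm y p, dist_comm y q] at h
    linarith

lemma exists_point (x y : X) {r : ℝ} (h0 : 0 ≤ r) (h1 : r ≤ dist x y) :
    ∃ p, dist x p = r ∧ dist p y = dist x y - r := by
  obtain ⟨S, hS, -⟩ := hX.existsUnique_segment x y
  obtain ⟨p, -, hp⟩ := hS.exists_point h0 h1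
  exact ⟨p, hp⟩

lemma exists_median (x y z : X) : ∃ m, dist x m + dist m y = dist x y ∧
    dist y m + dist m z = dist y z ∧ dist x m + dist m z = dist x z := by
  have t1 := dist_triangle x y z
  have t2 := dist_triangle x z y
  have t3 := dist_triangle y x z
  have c1 := dist_comm x y
  have c2 := dist_comm z y
  -- The distance from `x` to the median is the Gromov product of `y` and `z` at `x`.
  obtain ⟨m, h1, h2⟩ := hX.exists_point x y
    (r := (dist x y + dist x z - dist y z) / 2) (by linarith) (by linarith)
  have c3 := dist_comm m y
  refine ⟨m, by linarith, ?_⟩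
  rcases hX.dist_add_dist_or (x := x) (y := y) (p := m) (by linarith) z with h | h <;>
    constructor <;> linarith

end IsRTree

/-! ### Convex sets, Helly's theorem and fixed points. -/

/-- A subset of a metric space is geodesically convex if it contains with any two points all the
points between them. -/
def IsGeodesicallyConvex {X : Type*} [MetricSpace X] (C : Set X) : Prop :=
  ∀ x ∈ C, ∀ y ∈ C, ∀ p, dist x p + dist p y = dist x y → p ∈ C

lemma IsGeodesicallyConvex.inter {X : Type*} [MetricSpace X] {C D : Set X}
    (hC : IsGeodesicallyConvex C) (hD : IsGeodesicallyConvex D) :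
    IsGeodesicallyConvex (C ∩ D) :=
  fun x hx y hy p hp => ⟨hC x hx.1 y hy.1 p hp, hD x hx.2 y hy.2 p hp⟩

namespace IsRTree

variable {X : Type*} [MetricSpace X] (hX : IsRTree X)
include hX

/-- The median of three points, one from each pairwise intersection, lies in all three sets. -/
lemma nonempty_inter_three {C D E : Set X} (hC : IsGeodesicallyConvex C)
    (hD : IsGeodesicallyConvex D) (hE : IsGeodesicallyConvex E) (h1 : (C ∩ D).Nonempty)
    (h2 : (D ∩ E).Nonempty) (h3 : (C ∩ E).Nonempty) : (C ∩ D ∩ E).Nonempty := by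
  obtain ⟨a, ha1, ha2⟩ := h1
  obtain ⟨b, hb1, hb2⟩ := h2
  obtain ⟨c, hc1, hc2⟩ := h3
  obtain ⟨m, m1, m2, m3⟩ := hX.exists_median a b c
  exact ⟨m, ⟨hC a ha1 c hc1 m m3, hD a ha2 b hb1 m m1⟩, hE b hb2 c hc2 m m2⟩

/-- Helly's theorem for finitely many convex subsets of a metric tree. -/
lemma helly {ι : Type*} (s : Finset ι) (C : ι → Set X) (D : Set X)
    (hC : ∀ i ∈ s, IsGeodesicallyConvex (C i)) (hD : IsGeodesicallyConvex D) (hne : D.Nonempty)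
    (hCD : ∀ i ∈ s, (C i ∩ D).Nonempty)
    (h : ∀ i ∈ s, ∀ j ∈ s, (C i ∩ C j).Nonempty) : ∃ x ∈ D, ∀ i ∈ s, x ∈ C i := by
  classical
  -- `D` absorbs the sets already treated; the case of three sets shows that the remaining ones
  -- still meet it.
  induction s using Finset.induction_on generalizing D with
  | empty => exact ⟨hne.some, hne.some_mem, by simp⟩
  | insert i s hi ih =>
    simp only [Finset.mem_insert, forall_eq_or_imp] at hC hCD h
    obtain ⟨x, hx, hxs⟩ := ih (C i ∩ D) hC.2 (hC.1.inter hD) hCD.1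
      (fun j hj => by
        rw [← Set.inter_assoc]
        exact hX.nonempty_inter_three (hC.2 j hj) hC.1 hD (h.2 j hj).1 hCD.1 (hCD.2 j hj))
      (fun j hj => (h.2 j hj).2)
    exact ⟨x, hx.2, by simpa using ⟨hx.1, hxs⟩⟩

lemma exists_forall_mem {ι : Type*} [Finite ι] (C : ι → Set X)
    (hC : ∀ i, IsGeodesicallyConvex (C i)) (h : ∀ i j, (C i ∩ C j).Nonempty) :
    ∃ x, ∀ i, x ∈ C i := by
  have := Fintype.ofFinite ι
  have hne := hX.nonempty
  obtain ⟨x, -, hx⟩ := hX.helly Finset.univ C Set.univ (fun i _ => hC i)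
    (fun _ _ _ _ _ _ => trivial) Set.univ_nonempty
    (fun i _ => by simpa using h i i) (fun i _ j _ => h i j)
  exact ⟨x, fun i => hx i (Finset.mem_univ i)⟩

variable {G : Type*} [Group G] [MulAction G X] [IsIsometricSMul G X]

lemma isGeodesicallyConvex_fixedPoints (H : Set G) :
    IsGeodesicallyConvex {x : X | ∀ g ∈ H, g • x = x} := by
  intro x hx y hy p hp g hg
  refine hX.eq_of_dist_eq hp ?_ ?_
  · conv_lhs => rw [← hx g hg]
    exact dist_smul g x p
  · conv_lhs => rw [← hy g hg]
    exact dist_smul g p y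

/-- A finite group of isometries fixes the midpoint of two points of any of its orbits. -/
lemma exists_fixed_of_finite (H : Subgroup G) [Finite H] (x : X) :
    ∃ m, (∀ g ∈ H, g • m = m) ∧ ∃ a ∈ H, ∃ b ∈ H,
      dist (a • x) m + dist m (b • x) = dist (a • x) (b • x) := by
  -- For two orbit points at maximal distance `D`, the tripod property puts the whole orbit within
  -- `D / 2` of their midpoint. An image of the midpoint has the same property, hence is the
  -- midpoint.
  obtain ⟨⟨a, b⟩, hab⟩ := Finite.exists_max fun q : H × H => dist (q.1.1 • x) (q.2.1 • x)
  set D := dist (a.1 • x) (b.1 • x) with hD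
  have hD0 : 0 ≤ D := dist_nonneg
  obtain ⟨m, h1, h2⟩ := hX.exists_point (a.1 • x) (b.1 • x) (r := D / 2) (by linarith)
    (by rw [← hD]; linarith)
  have hrad : ∀ c ∈ H, dist m (c • x) ≤ D / 2 := by
    intro c hc
    have e1 := hab (a, ⟨c, hc⟩)
    have e2 := hab (b, ⟨c, hc⟩)
    simp only at e1 e2
    rcases hX.dist_add_dist_or (x := a.1 • x) (y := b.1 • x) (p := m) (by linarith) (c • x)
      with h | h
    · linarith
    · rw [dist_comm _ m] at h
      linarith
  refine ⟨m, fun g hg => ?_, a, a.2, b, b.2, by linarith⟩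
  have hgm : ∀ c ∈ H, dist (c • x) (g • m) ≤ D / 2 := by
    intro c hc
    have := hrad (g⁻¹ * c) (H.mul_mem (H.inv_mem hg) hc)
    rwa [← dist_smul g, mul_smul, smul_inv_smul, dist_comm] at this
  have ea := hgm a a.2
  have eb := hgm b b.2
  rw [dist_comm] at eb
  have := dist_triangle (a.1 • x) (g • m) (b.1 • x)
  exact hX.eq_of_dist_eq (by linarith) (by linarith) (by linarith)

/-- `K` permutes the fixed points of `H`. So the `K`-orbit of one of them stays in a convex set,
which then contains the `K`-fixed midpoint. -/
lemma exists_fixed_of_commute (H K : Subgroup G) [Finite H] [Finite K]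
    (hHK : ∀ h ∈ H, ∀ k ∈ K, h * k = k * h) :
    ∃ x : X, (∀ h ∈ H, h • x = x) ∧ ∀ k ∈ K, k • x = x := by
  obtain ⟨x⟩ := hX.nonempty
  obtain ⟨y, hy, -⟩ := hX.exists_fixed_of_finite H x
  obtain ⟨m, hm, a, ha, b, hb, hab⟩ := hX.exists_fixed_of_finite K y
  refine ⟨m, ?_, hm⟩
  have hK : ∀ k ∈ K, ∀ h ∈ H, h • k • y = k • y := by
    intro k hk h hh
    rw [← mul_smul, hHK h hh k hk, mul_smul, hy h hh]
  exact hX.isGeodesicallyConvex_fixedPoints (H : Set G) _ (hK a ha) _ (hK b hb) m hab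

/-- If `a * b` fixes `x`, then `a • x = b • x`. Both involutions swap `x` with this point and fix
the midpoint. -/
lemma exists_fixed_of_involutions {a b : G} (ha : a * a = 1) (hb : b * b = 1)
    (hab : IsOfFinOrder (a * b)) : ∃ x : X, a • x = x ∧ b • x = x := by
  obtain ⟨y⟩ := hX.nonempty
  have : Finite (Subgroup.zpowers (a * b)) := by
    rw [← SetLike.coe_sort_coe, Set.finite_coe_iff]
    exact finite_zpowers.2 hab
  obtain ⟨x, hx, -⟩ := hX.exists_fixed_of_finite (Subgroup.zpowers (a * b)) y
  have hx := hx _ (Subgroup.mem_zpowers _)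
  have hax : a • a • x = x := by rw [← mul_smul, ha, one_smul]
  have hbx : b • x = a • x := by
    conv_rhs => rw [← hx]
    rw [mul_smul, ← mul_smul a a, ha, one_smul]
  have hbax : b • a • x = x := by rw [← hbx, ← mul_smul, hb, one_smul]
  have h0 : (0 : ℝ) ≤ dist x (a • x) := dist_nonneg
  obtain ⟨m, h1, h2⟩ := hX.exists_point x (a • x) (r := dist x (a • x) / 2) (by linarith)
    (by linarith)
  have key : ∀ c : G, c • x = a • x → c • a • x = x → c • m = m := by
    intro c hc1 hc2
    refine hX.eq_of_dist_eq (x := x) (y := a • x) (by linarith) ?_ ?_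
    · have := dist_smul c m (a • x)
      rw [hc2, dist_comm] at this
      linarith
    · have := dist_smul c x m
      rw [hc1, dist_comm] at this
      linarith
  exact ⟨m, key a rfl hax, key b hbx hbax⟩

end IsRTree

/-! ### Complete graphs give property `Fℝ`. -/

/-- A group generated by finitely many subsets, any two of which have a common fixed point in
every metric tree on which the group acts, has property `Fℝ`. -/
lemma hasPropertyFR_of_pairwise {G : Type*} [Group G] {ι : Type*} [Finite ι] (H : ι → Set G)
    (hgen : Subgroup.closure (⋃ i, H i) = ⊤)
    (hpair : ∀ (X : Type w) [MetricSpace X] [MulAction G X] [IsIsometricSMul G X], IsRTree X →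
      ∀ i j, ∃ x : X, (∀ g ∈ H i, g • x = x) ∧ ∀ g ∈ H j, g • x = x) :
    HasPropertyFR.{w} G := by
  intro X _ _ _ hX
  obtain ⟨x, hx⟩ := hX.exists_forall_mem (fun i => {x : X | ∀ g ∈ H i, g • x = x})
    (fun i => hX.isGeodesicallyConvex_fixedPoints (H i)) (hpair X hX)
  refine ⟨x, fun g => ?_⟩
  have : Subgroup.closure (⋃ i, H i) ≤ MulAction.stabilizer G x := by
    rw [Subgroup.closure_le]
    intro g hg
    obtain ⟨i, hi⟩ := Set.mem_iUnion.1 hg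
    exact hx i g hi
  rw [hgen] at this
  exact this (Subgroup.mem_top g)

lemma GraphProduct.hasPropertyFR {V : Type u} [Finite V] (G : V → Type v) [∀ i, Group (G i)]
    [∀ i, Finite (G i)] : HasPropertyFR.{w} (GraphProduct (⊤ : SimpleGraph V) G) := by
  let N := Subgroup.normalClosure (graphProductRelators (⊤ : SimpleGraph V) G)
  let f : ∀ i, G i →* GraphProduct (⊤ : SimpleGraph V) G := fun i =>
    (QuotientGroup.mk' N).comp Monoid.CoprodI.of
  refine hasPropertyFR_of_pairwise (fun i => ((f i).range : Set _)) ?_ ?_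
  · rw [Subgroup.closure_iUnion]
    simp only [Subgroup.closure_eq, ← Monoid.CoprodI.range_eq_iSup]
    have : Monoid.CoprodI.lift f = QuotientGroup.mk' N :=
      Monoid.CoprodI.ext_hom _ _ fun i => by ext; simp [f]
    rw [this]
    exact MonoidHom.range_eq_top.2 (QuotientGroup.mk'_surjective N)
  · intro X _ _ _ hX i j
    have hfin : ∀ i, Finite (f i).range := fun i =>
      Finite.of_surjective _ (f i).rangeRestrict_surjective
    by_cases hij : i = j
    · subst hij
      obtain ⟨x⟩ := hX.nonempty
      obtain ⟨y, hy, -⟩ := hX.exists_fixed_of_finite (f i).range x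
      exact ⟨y, hy, hy⟩
    · refine hX.exists_fixed_of_commute (f i).range (f j).range ?_
      rintro _ ⟨g, rfl⟩ _ ⟨h, rfl⟩
      rw [← mul_inv_eq_one, mul_inv_rev, ← mul_assoc]
      have hmem : Monoid.CoprodI.of g * Monoid.CoprodI.of h * (Monoid.CoprodI.of g)⁻¹ *
          (Monoid.CoprodI.of h)⁻¹ ∈ N := Subgroup.subset_normalClosure ⟨i, j, hij, g, h, rfl⟩
      have := (QuotientGroup.eq_one_iff _).2 hmem
      exact this

lemma GraphCoxeterGroup.hasPropertyFR {V : Type u} [Finite V]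
    (φ : (⊤ : SimpleGraph V).edgeSet → ℕ) (hφ : ∀ e, 2 ≤ φ e) :
    HasPropertyFR.{w} (GraphCoxeterGroup ⊤ φ hφ) := by
  let M := labelledCoxeterMatrix ⊤ φ hφ
  let cs := M.toCoxeterSystem
  refine hasPropertyFR_of_pairwise (fun i => {cs.simple i}) ?_ ?_
  · rw [Set.iUnion_singleton_eq_range]
    exact cs.subgroup_closure_range_simple
  · intro X _ _ _ hX i j
    have hM : 0 < M i j := by
      by_cases hij : i = j
      · subst hij
        simp
      · have : M i j = φ ⟨s(i, j), hij⟩ := by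
          change (labelledCoxeterMatrix ⊤ φ hφ).M i j = _
          simp [labelledCoxeterMatrix, hij]
        have := hφ ⟨s(i, j), hij⟩
        omega
    obtain ⟨x, hx⟩ := hX.exists_fixed_of_involutions (cs.simple_mul_simple_self i)
      (cs.simple_mul_simple_self j) (isOfFinOrder_iff_pow_eq_one.2
        ⟨M i j, hM, cs.simple_mul_simple_pow i j⟩)
    exact ⟨x, by simpa using hx⟩

/-! ### The four-point condition characterises metric trees among geodesic spaces. -/

/-- Gromov's four-point condition for a `0`-hyperbolic space. -/
def FourPointCondition {S : Type*} (d : S → S → ℝ) : Prop :=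
  ∀ x y z t, d x y + d z t ≤ max (d x z + d y t) (d x t + d y z)

section UnionSegment

variable {X : Type*} [MetricSpace X]

lemma IsGeodesicSegment.dist_left {x y : X} {γ : ℝ → X} (h0 : γ 0 = x)
    (hγ : ∀ s ∈ Set.Icc 0 (dist x y), ∀ t ∈ Set.Icc 0 (dist x y), dist (γ s) (γ t) = |s - t|)
    {t : ℝ} (ht : t ∈ Set.Icc 0 (dist x y)) : dist x (γ t) = t := by
  have e1 := hγ 0 ⟨le_rfl, dist_nonneg⟩ t ht
  rwa [h0, zero_sub, abs_neg, abs_of_nonneg ht.1] at e1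

lemma IsGeodesicSegment.dist_right {x y : X} {γ : ℝ → X} (h1 : γ (dist x y) = y)
    (hγ : ∀ s ∈ Set.Icc 0 (dist x y), ∀ t ∈ Set.Icc 0 (dist x y), dist (γ s) (γ t) = |s - t|)
    {t : ℝ} (ht : t ∈ Set.Icc 0 (dist x y)) : dist (γ t) y = dist x y - t := by
  have e1 := hγ t ht (dist x y) ⟨dist_nonneg, le_rfl⟩
  rwa [h1, abs_sub_comm, abs_of_nonneg (by linarith [ht.2])] at e1

/-- Two geodesic segments with a common end form a geodesic segment if the lengths add up. -/
lemma IsGeodesicSegment.union {x y z : X} {S T : Set X} (hS : IsGeodesicSegment y x S)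
    (hT : IsGeodesicSegment x z T) (hd : dist y x + dist x z = dist y z) :
    IsGeodesicSegment y z (S ∪ T) := by
  obtain ⟨γ, g0, g1, hγ, rfl⟩ := hS
  obtain ⟨δ, d0, d1, hδ, rfl⟩ := hT
  have ha : (0 : ℝ) ≤ dist y x := dist_nonneg
  have hb : (0 : ℝ) ≤ dist x z := dist_nonneg
  set a := dist y x with haa
  set b := dist x z with hbb
  let η : ℝ → X := fun t => if t ≤ a then γ t else δ (t - a)
  have η1 : ∀ t, t ≤ a → η t = γ t := fun t ht => if_pos ht
  have η2 : ∀ t, a ≤ t → η t = δ (t - a) := by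
    intro t ht
    rcases ht.eq_or_lt with rfl | ht
    · rw [η1 _ le_rfl, sub_self, d0, g1]
    · exact if_neg (not_le.2 ht)
  have hmixed : ∀ s ∈ Set.Icc 0 a, ∀ t ∈ Set.Icc 0 b, dist (γ s) (δ t) = a + t - s := by
    intro s hs t ht
    have e1 := dist_right g1 hγ hs
    have e2 := dist_left d0 hδ ht
    have e3 := dist_left g0 hγ hs
    have e4 := dist_right d1 hδ ht
    have t1 := dist_triangle (γ s) x (δ t)
    have t2 := dist_triangle4 y (γ s) (δ t) z
    linarith
  have hle : ∀ s ∈ Set.Icc 0 (a + b), ∀ t ∈ Set.Icc 0 (a + b), s ≤ t →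
      dist (η s) (η t) = t - s := by
    intro s hs t ht hst
    rcases le_total t a with hta | hta
    · rw [η1 t hta, η1 s (hst.trans hta), hγ s ⟨hs.1, hst.trans hta⟩ t ⟨ht.1, hta⟩, abs_sub_comm,
        abs_of_nonneg (by linarith)]
    · rw [η2 t hta]
      have ht' : t - a ∈ Set.Icc 0 b := ⟨by linarith, by linarith [ht.2]⟩
      rcases le_total s a with hsa | hsa
      · rw [η1 s hsa, hmixed s ⟨hs.1, hsa⟩ _ ht']
        ring
      · rw [η2 s hsa, hδ _ ⟨by linarith, by linarith [hs.2]⟩ _ ht', abs_sub_comm,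
          abs_of_nonneg (by linarith)]
        ring
  refine ⟨η, by rw [η1 0 ha, g0], by rw [← hd, η2 _ (by linarith), add_sub_cancel_left, d1], ?_, ?_⟩
  · rw [← hd]
    intro s hs t ht
    rcases le_total s t with hst | hst
    · rw [hle s hs t ht hst, abs_sub_comm, abs_of_nonneg (by linarith)]
    · rw [dist_comm, hle t ht s hs hst, abs_of_nonneg (by linarith)]
  · rw [← hd]
    ext q
    constructor
    · rintro (⟨t, ht, rfl⟩ | ⟨t, ht, rfl⟩)
      · exact ⟨t, ⟨ht.1, by linarith [ht.2]⟩, η1 t ht.2⟩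
      · refine ⟨a + t, ⟨by linarith [ht.1], by linarith [ht.2]⟩, ?_⟩
        rw [η2 _ (by linarith [ht.1]), add_sub_cancel_left]
    · rintro ⟨t, ht, rfl⟩
      rcases le_total t a with hta | hta
      · exact .inl ⟨t, ⟨ht.1, hta⟩, (η1 t hta).symm⟩
      · exact .inr ⟨t - a, ⟨by linarith, by linarith [ht.2]⟩, (η2 t hta).symm⟩

end UnionSegment

/-- A geodesic metric space which satisfies the four-point condition is a metric tree. -/
lemma FourPointCondition.isRTree {X : Type*} [MetricSpace X] [Nonempty X]
    (h4 : FourPointCondition (dist : X → X → ℝ))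
    (hgeo : ∀ x y : X, ∃ S, IsGeodesicSegment x y S) : IsRTree X := by
  have hsub : ∀ {x y : X} {S T : Set X}, IsGeodesicSegment x y S → IsGeodesicSegment x y T →
      S ⊆ T := by
    rintro x y _ _ ⟨γ, g0, g1, hγ, rfl⟩ ⟨δ, d0, d1, hδ, rfl⟩ _ ⟨t, ht, rfl⟩
    refine ⟨t, ht, ?_⟩
    have e1 := IsGeodesicSegment.dist_left g0 hγ ht
    have e2 := IsGeodesicSegment.dist_left d0 hδ ht
    have e3 := IsGeodesicSegment.dist_right g1 hγ ht
    have e4 := IsGeodesicSegment.dist_right d1 hδ ht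
    have := h4 (δ t) (γ t) x y
    rw [dist_comm (δ t) x, dist_comm (γ t) x, e1, e2, e3, e4, add_sub_cancel,
      sub_add_cancel, max_self] at this
    exact dist_le_zero.1 (by linarith)
  refine ⟨inferInstance, fun x y => ?_, ?_⟩
  · obtain ⟨S, hS⟩ := hgeo x y
    exact ⟨S, hS, fun T hT => (hsub hT hS).antisymm (hsub hS hT)⟩
  · intro x y z S T hS hT hST
    refine hS.union hT ?_
    obtain ⟨γ, g0, g1, hγ, hSe⟩ := hS
    obtain ⟨δ, d0, d1, hδ, hTe⟩ := hT
    have t1 := dist_triangle y x z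
    have t2 := dist_triangle x y z
    have t3 := dist_triangle y z x
    rw [dist_comm x y] at t2
    rw [dist_comm z x] at t3
    -- The segments from `x` to `y` and to `z` should run together for the length `r`, the Gromov
    -- product at `x`. The four-point condition identifies their points at distance `r` from `x`; as
    -- the segments share only `x`, `r = 0`.
    set r := (dist y x + dist x z - dist y z) / 2 with hr
    have hr1 : dist y x - r ∈ Set.Icc 0 (dist y x) := ⟨by linarith, by linarith⟩
    have hr2 : r ∈ Set.Icc 0 (dist x z) := ⟨by linarith, by linarith⟩
    have e1 := IsGeodesicSegment.dist_left g0 hγ hr1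
    have e2 := IsGeodesicSegment.dist_left d0 hδ hr2
    have e3 := IsGeodesicSegment.dist_right g1 hγ hr1
    have e4 := IsGeodesicSegment.dist_right d1 hδ hr2
    set p := γ (dist y x - r)
    set q := δ r
    have f1 : dist p z ≤ dist x z - r := by
      have := h4 p z y x
      rw [dist_comm p y, dist_comm z x, dist_comm z y] at this
      rcases le_max_iff.1 this with h | h <;> linarith
    have f2 : dist p q ≤ 0 := by
      have := h4 p q x z
      rw [dist_comm q x] at this
      rcases le_max_iff.1 this with h | h <;> linarith
    have hpq : p = q := dist_le_zero.1 f2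
    have hp : p ∈ S ∩ T := by
      rw [hSe, hTe]
      exact ⟨⟨_, hr1, rfl⟩, ⟨_, hr2, hpq.symm⟩⟩
    rw [hST, Set.mem_singleton_iff] at hp
    rw [hp, dist_self] at e3
    linarith

/-! ### The metric tree spanned by an invariant four-point pseudometric. -/

/-- A pseudometric on `S` that satisfies the four-point condition and is invariant under a group
action. -/
structure InvariantTreeMetric (G S : Type*) [Group G] [MulAction G S] where
  /-- The distance. -/
  d : S → S → ℝ
  self : ∀ x, d x x = 0
  comm : ∀ x y, d x y = d y x
  fourPoint : FourPointCondition d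
  smul : ∀ (g : G) x y, d (g • x) (g • y) = d x y

variable {G S : Type*} [Group G] [MulAction G S]

/-- A point on the segment between two points of `S`, given by its distances to these points. -/
@[ext]
structure InvariantTreeMetric.Point (D : InvariantTreeMetric G S) where
  /-- The two ends of the segment. -/
  pt : Bool → S
  /-- The distances to the two ends of the segment. -/
  wt : Bool → ℝ
  wt_nonneg : ∀ i, 0 ≤ wt i
  wt_add : wt false + wt true = D.d (pt false) (pt true)

namespace InvariantTreeMetric

variable {D : InvariantTreeMetric G S}

/-- The contribution of a pair of ends to the distance of two points. -/
def Point.term (P Q : D.Point) (i j : Bool) : ℝ := D.d (P.pt i) (Q.pt j) - P.wt i - Q.wt j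

/-- The distance of two points. -/
noncomputable def Point.d (P Q : D.Point) : ℝ :=
  max (max (P.term Q false false) (P.term Q false true))
    (max (P.term Q true false) (P.term Q true true))

namespace Point

/-- In a tree each term is at most the distance, by the triangle inequality, and some pair of ends
gives equality, by the tripod property. Hence the maximum in `Point.d`. -/
lemma term_le_d (P Q : D.Point) (i j : Bool) : P.term Q i j ≤ P.d Q := by
  cases i <;> cases j <;> simp [Point.d]

lemma exists_d_eq (P Q : D.Point) : ∃ i j, P.d Q = P.term Q i j := by
  unfold Point.d
  rcases max_choice (max (P.term Q false false) (P.term Q false true))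
    (max (P.term Q true false) (P.term Q true true)) with h | h <;> rw [h]
  · rcases max_choice (P.term Q false false) (P.term Q false true) with h | h <;> rw [h] <;>
      exact ⟨_, _, rfl⟩
  · rcases max_choice (P.term Q true false) (P.term Q true true) with h | h <;> rw [h] <;>
      exact ⟨_, _, rfl⟩

lemma d_le_iff (P Q : D.Point) (r : ℝ) : P.d Q ≤ r ↔ ∀ i j, P.term Q i j ≤ r := by
  simp [Point.d, and_assoc]

lemma d_self (P : D.Point) : P.d P = 0 := by
  have h := P.wt_add
  have h0 := P.wt_nonneg false
  have h1 := P.wt_nonneg true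
  have hc := D.comm (P.pt true) (P.pt false)
  refine le_antisymm ((d_le_iff _ _ _).2 ?_) ?_
  · rintro (_ | _) (_ | _) <;> simp only [term, D.self] <;> linarith
  · have := P.term_le_d P false true
    simp only [term] at this
    linarith

lemma d_comm (P Q : D.Point) : P.d Q = Q.d P := by
  have hle : ∀ P Q : D.Point, P.d Q ≤ Q.d P := by
    intro P Q
    refine (d_le_iff _ _ _).2 fun i j => le_trans (le_of_eq ?_) (term_le_d Q P j i)
    simp only [term, D.comm (P.pt i)]
    ring
  exact (hle P Q).antisymm (hle Q P)

/-- For ends that realise the two distances on the left, the condition is inherited from `D`: the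
same four weights are subtracted on both sides. -/
lemma fourPoint_d : FourPointCondition (Point.d : D.Point → D.Point → ℝ) := by
  intro P Q R T
  obtain ⟨a, b, h1⟩ := P.exists_d_eq Q
  obtain ⟨c, e, h2⟩ := R.exists_d_eq T
  have h3 := D.fourPoint (P.pt a) (Q.pt b) (R.pt c) (T.pt e)
  have k1 := P.term_le_d R a c
  have k2 := Q.term_le_d T b e
  have k3 := P.term_le_d T a e
  have k4 := Q.term_le_d R b c
  simp only [term] at h1 h2 k1 k2 k3 k4
  rw [h1, h2]
  rcases le_max_iff.1 h3 with h | h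
  · exact le_max_of_le_left (by linarith)
  · exact le_max_of_le_right (by linarith)

noncomputable instance : PseudoMetricSpace D.Point where
  dist := Point.d
  dist_self := d_self
  dist_comm := d_comm
  dist_triangle P Q R := by
    have := fourPoint_d P R Q Q
    rwa [d_self, add_zero, d_comm R Q, max_self] at this

lemma dist_eq (P Q : D.Point) : dist P Q = P.d Q := rfl

instance : MulAction G D.Point where
  smul g P := ⟨fun i => g • P.pt i, P.wt, P.wt_nonneg, by rw [P.wt_add, D.smul]⟩
  one_smul P := Point.ext (funext fun i => one_smul G (P.pt i)) rfl
  mul_smul g h P := Point.ext (funext fun i => mul_smul g h (P.pt i)) rfl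

lemma smul_pt (g : G) (P : D.Point) (i : Bool) : (g • P).pt i = g • P.pt i := rfl

lemma smul_wt (g : G) (P : D.Point) (i : Bool) : (g • P).wt i = P.wt i := rfl

lemma smul_d (g : G) (P Q : D.Point) : (g • P).d (g • Q) = P.d Q := by
  simp only [Point.d, term, smul_pt, smul_wt, D.smul]

instance : IsIsometricSMul G D.Point :=
  ⟨fun g => Isometry.of_dist_eq fun P Q => smul_d g P Q⟩

variable (D) in
/-- The point of `S`, as a point of a degenerate segment. -/
def ofBase (x : S) : D.Point := ⟨fun _ => x, fun _ => 0, fun _ => le_rfl, by simp [D.self]⟩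

/-- The point at distance `t` from the first end of the segment between two points of `S`. -/
noncomputable def onSegment (x y : S) (t : ℝ) (h0 : 0 ≤ t) (h1 : t ≤ D.d x y) : D.Point where
  pt i := cond i y x
  wt i := cond i (D.d x y - t) t
  wt_nonneg i := by cases i <;> simp [h0, h1]
  wt_add := by simp

lemma dist_onSegment (x y : S) {t s : ℝ} (h0 : 0 ≤ t) (h1 : t ≤ D.d x y) (k0 : 0 ≤ s)
    (k1 : s ≤ D.d x y) : dist (onSegment x y t h0 h1) (onSegment x y s k0 k1) = |t - s| := by
  have hc := D.comm y x
  rw [dist_eq]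
  refine le_antisymm ((d_le_iff _ _ _).2 ?_) (abs_le'.2 ⟨?_, ?_⟩)
  · rintro (_ | _) (_ | _) <;> simp only [term, onSegment, cond_true, cond_false, D.self]
    · linarith [abs_nonneg (t - s)]
    · linarith [neg_le_abs (t - s)]
    · linarith [le_abs_self (t - s)]
    · linarith [abs_nonneg (t - s)]
  · refine le_trans (le_of_eq ?_) (term_le_d _ _ true false)
    simp only [term, onSegment, cond_true, cond_false]
    linarith
  · refine le_trans (le_of_eq ?_) (term_le_d _ _ false true)
    simp only [term, onSegment, cond_true, cond_false]
    linarith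

lemma dist_onSegment_swap (x y : S) {t s : ℝ} (h0 : 0 ≤ t) (h1 : t ≤ D.d x y) (k0 : 0 ≤ s)
    (k1 : s ≤ D.d y x) (hts : t + s = D.d x y) :
    dist (onSegment x y t h0 h1) (onSegment y x s k0 k1) = 0 := by
  have hc := D.comm y x
  refine le_antisymm ?_ dist_nonneg
  rw [dist_eq, d_le_iff]
  rintro (_ | _) (_ | _) <;> simp only [term, onSegment, cond_true, cond_false, D.self] <;> linarith

lemma d_pt_le (P : D.Point) (i j : Bool) : D.d (P.pt i) (P.pt j) ≤ P.wt i + P.wt j := by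
  have hw := P.wt_add
  have h0 := P.wt_nonneg false
  have h1 := P.wt_nonneg true
  have hc := D.comm (P.pt true) (P.pt false)
  rcases i with _ | _ <;> rcases j with _ | _ <;> try simp only [D.self]
  all_goals linarith

/-- A point from which the distance to `Q` is computed with the end `i` lies on the segment from
this end to the relevant end of `Q`. -/
lemma dist_onSegment_of_d_eq {P Q : D.Point} {i j : Bool} (h : P.d Q = P.term Q i j)
    (h1 : P.wt i ≤ D.d (P.pt i) (Q.pt j)) :
    dist P (onSegment (P.pt i) (Q.pt j) (P.wt i) (P.wt_nonneg i) h1) = 0 := by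
  have hmax : ∀ k, P.term Q k j ≤ P.term Q i j := fun k => h ▸ P.term_le_d Q k j
  refine le_antisymm ?_ dist_nonneg
  rw [dist_eq, d_le_iff]
  rintro k (_ | _)
  · simp only [term, onSegment, cond_false]
    linarith [P.d_pt_le k i]
  · have := hmax k
    simp only [term, onSegment, cond_true] at this ⊢
    linarith

end Point

variable (D) in
/-- The metric tree spanned by `S`. -/
abbrev Tree := SeparationQuotient D.Point

namespace Tree

/-- Ends that realise the distance of `P` and `Q` span a segment through both points; the geodesic
is its part between them. -/
lemma exists_isGeodesicSegment (x y : Tree D) : ∃ T, IsGeodesicSegment x y T := by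
  obtain ⟨P, rfl⟩ := SeparationQuotient.surjective_mk x
  obtain ⟨Q, rfl⟩ := SeparationQuotient.surjective_mk y
  obtain ⟨i, j, h⟩ := Point.exists_d_eq P Q
  have h' : Q.d P = Q.term P j i := by
    rw [Point.d_comm, h]
    simp only [Point.term, D.comm (P.pt i)]
    ring
  have hd : dist (SeparationQuotient.mk P) (SeparationQuotient.mk Q) = P.d Q := rfl
  have hnn : 0 ≤ P.d Q := dist_nonneg (x := P) (y := Q)
  have hterm : P.d Q = D.d (P.pt i) (Q.pt j) - P.wt i - Q.wt j := h
  have hP := P.wt_nonneg i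
  have hQ := Q.wt_nonneg j
  let γ : ℝ → Tree D := fun t =>
    if ht : 0 ≤ t ∧ t ≤ P.d Q then SeparationQuotient.mk
      (Point.onSegment (P.pt i) (Q.pt j) (P.wt i + t) (by linarith) (by linarith))
    else SeparationQuotient.mk P
  have hγ : ∀ t (ht : 0 ≤ t ∧ t ≤ P.d Q), γ t = SeparationQuotient.mk
      (Point.onSegment (P.pt i) (Q.pt j) (P.wt i + t) (by linarith) (by linarith)) :=
    fun t ht => dif_pos ht
  refine ⟨_, γ, ?_, ?_, ?_, rfl⟩
  · rw [hγ 0 ⟨le_rfl, hnn⟩, eq_comm, ← dist_eq_zero, SeparationQuotient.dist_mk]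
    simp only [add_zero]
    exact Point.dist_onSegment_of_d_eq h _
  · rw [hd, hγ _ ⟨hnn, le_rfl⟩, ← dist_eq_zero, SeparationQuotient.dist_mk]
    have hcomm := D.comm (Q.pt j) (P.pt i)
    -- `Q` is found on the same segment, but parametrised from the other end.
    have h1 := Point.dist_onSegment_of_d_eq h' (by linarith)
    have h2 := Point.dist_onSegment_swap (D := D) (P.pt i) (Q.pt j) (t := P.wt i + P.d Q)
      (s := Q.wt j) (by linarith) (by linarith) hQ (by linarith) (by linarith)
    refine le_antisymm ((dist_triangle_right _ _ _).trans (add_nonpos h2.le h1.le)) dist_nonneg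
  · rw [hd]
    intro s hs t ht
    rw [hγ s hs, hγ t ht, SeparationQuotient.dist_mk, Point.dist_onSegment]
    congr 1
    ring

lemma fourPoint : FourPointCondition (dist : Tree D → Tree D → ℝ) := by
  intro x y z t
  obtain ⟨P, rfl⟩ := SeparationQuotient.surjective_mk x
  obtain ⟨Q, rfl⟩ := SeparationQuotient.surjective_mk y
  obtain ⟨R, rfl⟩ := SeparationQuotient.surjective_mk z
  obtain ⟨T, rfl⟩ := SeparationQuotient.surjective_mk t
  exact Point.fourPoint_d P Q R T

lemma isRTree [Nonempty S] : IsRTree (Tree D) := by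
  have : Nonempty (Tree D) := ⟨SeparationQuotient.mk (Point.ofBase D (Classical.arbitrary S))⟩
  exact fourPoint.isRTree exists_isGeodesicSegment

instance : IsIsometricSMul G (Tree D) := by
  refine ⟨fun g => Isometry.of_dist_eq fun x y => ?_⟩
  obtain ⟨P, rfl⟩ := SeparationQuotient.surjective_mk x
  obtain ⟨Q, rfl⟩ := SeparationQuotient.surjective_mk y
  exact Point.smul_d g P Q

lemma dist_ofBase (x y : S) :
    dist (SeparationQuotient.mk (Point.ofBase D x)) (SeparationQuotient.mk (Point.ofBase D y)) =
      D.d x y := by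
  rw [SeparationQuotient.dist_mk, Point.dist_eq]
  simp [Point.d, Point.term, Point.ofBase]

end Tree

end InvariantTreeMetric

/-- A group with a left-invariant unbounded pseudometric that satisfies the four-point condition
does not have property `Fℝ`. -/
lemma not_hasPropertyFR_of_unbounded {G : Type*} [Group G] [Countable G] (d : G → G → ℝ)
    (hself : ∀ x, d x x = 0) (hcomm : ∀ x y, d x y = d y x) (h4 : FourPointCondition d)
    (hinv : ∀ g x y, d (g * x) (g * y) = d x y) (hunb : ∀ r, ∃ g, r < d 1 g) :
    ¬ HasPropertyFR.{w} G := by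
  intro hFR
  -- The tree has to live in the universe `w`, so it is built on a copy of the countable group
  -- there.
  let e := equivShrink.{w} G
  let _ : MulAction G (Shrink.{w} G) := e.symm.mulAction G
  have he : ∀ (g : G) (x : Shrink.{w} G), e.symm (g • x) = g * e.symm x := fun g x => by
    change e.symm (e (g * e.symm x)) = _
    rw [Equiv.symm_apply_apply]
  let D : InvariantTreeMetric G (Shrink.{w} G) :=
    { d := fun x y => d (e.symm x) (e.symm y)
      self := fun x => hself _
      comm := fun x y => hcomm _ _
      fourPoint := fun x y z t => h4 _ _ _ _
      smul := fun g x y => by rw [he, he, hinv] }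
  obtain ⟨x, hx⟩ := hFR D.Tree InvariantTreeMetric.Tree.isRTree
  let o : D.Tree := SeparationQuotient.mk (InvariantTreeMetric.Point.ofBase D (e 1))
  obtain ⟨g, hg⟩ := hunb (2 * dist o x)
  have h1 : dist o (g • o) = d 1 g := by
    have : g • o = SeparationQuotient.mk (InvariantTreeMetric.Point.ofBase D (g • e 1)) := rfl
    rw [this, InvariantTreeMetric.Tree.dist_ofBase]
    change d (e.symm (e 1)) (e.symm (g • e 1)) = _
    rw [he, Equiv.symm_apply_apply, mul_one]
  have h2 : dist x (g • o) = dist o x := by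
    conv_lhs => rw [← hx g]
    rw [dist_smul, dist_comm]
  linarith [dist_triangle o x (g • o)]

/-! ### Word length in amalgamated products. -/

namespace Monoid.PushoutI

section Overlap

variable {ι : Type*} {G : ι → Type*}

open Classical in
/-- Twice the Gromov product of two lists of letters: a common letter counts twice, and the first
letters that differ count once if they belong to the same factor. -/
noncomputable def overlap : List (Σ i, G i) → List (Σ i, G i) → ℕ
  | a :: l, b :: l' => if a = b then 2 + overlap l l' else if a.1 = b.1 then 1 else 0
  | _, _ => 0

lemma overlap_comm (l l' : List (Σ i, G i)) : overlap l l' = overlap l' l := by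
  induction l generalizing l' with
  | nil => cases l' <;> simp [overlap]
  | cons a l ih =>
    cases l' with
    | nil => simp [overlap]
    | cons b l' =>
      simp only [overlap, ih l']
      grind

/-- Agreement up to a given depth is transitive, and so is belonging to the same factor at the first
difference. -/
lemma min_overlap_le (l₁ l₂ l₃ : List (Σ i, G i)) :
    min (overlap l₁ l₂) (overlap l₂ l₃) ≤ overlap l₁ l₃ := by
  induction l₁ generalizing l₂ l₃ with
  | nil => cases l₂ <;> simp [overlap]
  | cons a l₁ ih =>
    cases l₂ with
    | nil => simp [overlap]
    | cons b l₂ =>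
      cases l₃ with
      | nil => simp [overlap]
      | cons c l₃ =>
        have := ih l₂ l₃
        simp only [overlap]
        grind

end Overlap

variable {ι : Type*} {G : ι → Type*} {H : Type*} [∀ i, Group (G i)] [Group H]
  {φ : ∀ i, H →* G i}

variable (φ) in
/-- The product in the pushout of a list of elements of the factors. -/
def listProd (l : List (Σ i, G i)) : PushoutI φ := (l.map fun p => of p.1 p.2).prod

@[simp]
lemma listProd_nil : listProd φ [] = 1 := rfl

@[simp]
lemma listProd_cons (p : Σ i, G i) (l : List (Σ i, G i)) :
    listProd φ (p :: l) = of p.1 p.2 * listProd φ l := by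
  simp [listProd]

@[simp]
lemma listProd_append (l l' : List (Σ i, G i)) :
    listProd φ (l ++ l') = listProd φ l * listProd φ l' := by
  simp [listProd]

/-- The inverse of a letter. -/
def invLetter (p : Σ i, G i) : Σ i, G i := ⟨p.1, p.2⁻¹⟩

lemma listProd_map_invLetter (l : List (Σ i, G i)) :
    listProd φ (l.map invLetter) = (listProd φ l.reverse)⁻¹ := by
  induction l with
  | nil => simp
  | cons p l ih => simp [ih, invLetter]

variable (φ) in
/-- A list of letters outside of the base group is reduced if successive letters belong to
different factors. -/
structure IsReducedList (l : List (Σ i, G i)) : Prop where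
  chain : (l.map Sigma.fst).IsChain (· ≠ ·)
  notMem : ∀ p ∈ l, p.2 ∉ (φ p.1).range

lemma isChain_ne_reverse {α : Type*} {l : List α} :
    l.reverse.IsChain (· ≠ ·) ↔ l.IsChain (· ≠ ·) := by
  rw [List.isChain_reverse]
  simp only [ne_comm]

variable (φ) in
lemma IsReducedList.nil : IsReducedList φ [] := ⟨List.isChain_nil, by simp⟩

lemma IsReducedList.map_invLetter {l : List (Σ i, G i)} (h : IsReducedList φ l) :
    IsReducedList φ (l.map invLetter) := by
  refine ⟨?_, ?_⟩
  · have := h.chain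
    rwa [List.map_map, show Sigma.fst ∘ invLetter (G := G) = Sigma.fst from rfl]
  · simp only [List.mem_map, forall_exists_index, and_imp]
    rintro _ p hp rfl
    exact fun hr => h.notMem p hp (inv_mem_iff.1 hr)

lemma IsReducedList.reverse {l : List (Σ i, G i)} (h : IsReducedList φ l) :
    IsReducedList φ l.reverse := by
  refine ⟨?_, fun p hp => h.notMem p (List.mem_reverse.1 hp)⟩
  rw [List.map_reverse, isChain_ne_reverse]
  exact h.chain

lemma IsReducedList.tail {p : Σ i, G i} {l : List (Σ i, G i)} (h : IsReducedList φ (p :: l)) :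
    IsReducedList φ l :=
  ⟨(List.isChain_cons.1 h.chain).2, fun q hq => h.notMem q (List.mem_cons_of_mem _ hq)⟩

variable (d : NormalWord.Transversal φ)

open Classical in
/-- The normal form of an element of the pushout. -/
noncomputable def normalForm (g : PushoutI φ) : NormalWord d := NormalWord.equiv g

variable {d}

lemma prod_normalForm (g : PushoutI φ) : (normalForm d g).prod = g := by
  classical
  exact (NormalWord.equiv (d := d)).symm_apply_apply g

lemma normalForm_prod (w : NormalWord d) : normalForm d w.prod = w :=
  NormalWord.prod_injective (prod_normalForm _)

lemma eq_of_mul_inv_mem_range {i : ι} {g g' : G i} (hg : g ∈ d.set i) (hg' : g' ∈ d.set i)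
    (h : g * g'⁻¹ ∈ (φ i).range) : g = g' := by
  have := @(d.compl i).1 (⟨_, h⟩, ⟨g', hg'⟩) (1, ⟨g, hg⟩) (by simp)
  simp only [Prod.mk.injEq, Subtype.mk.injEq] at this
  exact this.2.symm

lemma isReducedList_toList (w : NormalWord d) : IsReducedList φ w.toList := by
  refine ⟨(List.isChain_map _).2 w.chain_ne, fun p hp hr => w.ne_one p hp ?_⟩
  exact eq_of_mul_inv_mem_range (w.normalized p.1 p.2 hp) (d.one_mem _) (by simpa using hr)

lemma eq_base_mul_listProd (g : PushoutI φ) :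
    g = base φ (normalForm d g).head * listProd φ (normalForm d g).toList := by
  conv_lhs => rw [← prod_normalForm (d := d) g]
  simp [NormalWord.prod, CoprodI.Word.prod, listProd, map_list_prod, Function.comp_def]

variable (d) in
/-- The number of letters of the normal form. -/
noncomputable def wordLength (g : PushoutI φ) : ℕ := (normalForm d g).toList.length

lemma wordLength_base_mul (h : H) (g : PushoutI φ) :
    wordLength d (base φ h * g) = wordLength d g := by
  unfold wordLength
  conv_lhs => rw [← prod_normalForm (d := d) g, ← NormalWord.prod_base_smul, normalForm_prod]
  rfl

/-- Passing to the normal form changes the letters of a reduced list but keeps their sequence of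
factors. -/
lemma wordLength_listProd {l : List (Σ i, G i)} (hl : IsReducedList φ l) :
    wordLength d (listProd φ l) = l.length := by
  let w : CoprodI.Word G := ⟨l, fun p hp h1 => hl.notMem p hp (h1 ▸ one_mem _),
    (List.isChain_map _).1 hl.chain⟩
  have hw : Reduced φ w := hl.notMem
  obtain ⟨w', h1, h2⟩ := hw.exists_normalWord_prod_eq d
  have h3 : ofCoprodI w.prod = listProd φ l := by
    simp [CoprodI.Word.prod, listProd, map_list_prod, Function.comp_def, w]
  rw [← h3, ← h1, wordLength, normalForm_prod]
  simpa using congrArg List.length h2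

/-- A base element on the right is absorbed by the last letter, which stays outside the base. -/
lemma wordLength_base_mul_listProd_mul_base {l : List (Σ i, G i)} (hl : IsReducedList φ l)
    (h h' : H) : wordLength d (base φ h * listProd φ l * base φ h') = l.length := by
  rw [mul_assoc, wordLength_base_mul]
  rcases List.eq_nil_or_concat l with rfl | ⟨l₀, ⟨i, g⟩, rfl⟩
  · rw [listProd_nil, one_mul, ← mul_one (base φ h'), wordLength_base_mul]
    exact wordLength_listProd (.nil φ)
  · have : listProd φ (l₀.concat ⟨i, g⟩) * base φ h' = listProd φ (l₀ ++ [⟨i, g * φ i h'⟩]) := by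
      simp [of_apply_eq_base, mul_assoc]
    rw [this, wordLength_listProd]
    · simp
    · refine ⟨by simpa using hl.chain, ?_⟩
      simp only [List.mem_append, List.mem_singleton]
      rintro p (hp | rfl)
      · exact hl.notMem p (by simp [hp])
      · intro hr
        refine hl.notMem ⟨i, g⟩ (by simp) ?_
        exact ((φ i).range.mul_mem_cancel_right ⟨h', rfl⟩).1 hr

lemma listProd_reverse_cons (p : Σ i, G i) (l : List (Σ i, G i)) :
    listProd φ (p :: l).reverse = listProd φ l.reverse * of p.1 p.2 := by
  simp

/-- The first letters of `l` and `l'` meet at the junction. Equal letters cancel, saving two.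
Distinct letters of one factor represent different cosets, so they merge into one letter outside the
base, saving one. Letters of different factors stay. -/
lemma wordLength_mul_inv {l l' : List (Σ i, G i)} (hl : IsReducedList φ l)
    (hl' : IsReducedList φ l') (hd : ∀ p ∈ l, p.2 ∈ d.set p.1) (hd' : ∀ p ∈ l', p.2 ∈ d.set p.1)
    (h h' : H) :
    wordLength d (base φ h * (listProd φ l.reverse * (listProd φ l'.reverse)⁻¹) * base φ h') +
      overlap l l' = l.length + l'.length := by
  induction l generalizing l' with
  | nil =>
    rw [← listProd_map_invLetter, List.reverse_nil, listProd_nil, one_mul,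
      wordLength_base_mul_listProd_mul_base hl'.map_invLetter]
    simp [overlap]
  | cons a l ih =>
    cases l' with
    | nil =>
      rw [List.reverse_nil, listProd_nil, inv_one, mul_one,
        wordLength_base_mul_listProd_mul_base hl.reverse]
      simp [overlap]
    | cons b l' =>
      by_cases hab : a = b
      · subst hab
        have := ih hl.tail hl'.tail (fun p hp => hd p (List.mem_cons_of_mem _ hp))
          (fun p hp => hd' p (List.mem_cons_of_mem _ hp))
        rw [listProd_reverse_cons, listProd_reverse_cons, mul_inv_rev,
          mul_assoc (listProd φ l.reverse), mul_inv_cancel_left]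
        simp only [overlap, if_true, List.length_cons]
        omega
      · rw [← listProd_map_invLetter]
        by_cases hi : a.1 = b.1
        · obtain ⟨i, g⟩ := a
          obtain ⟨j, g'⟩ := b
          obtain rfl : i = j := hi
          have hne : g * g'⁻¹ ∉ (φ i).range := by
            intro hr
            have := eq_of_mul_inv_mem_range (d := d) (hd ⟨i, g⟩ List.mem_cons_self)
              (hd' ⟨i, g'⟩ List.mem_cons_self) hr
            exact hab (congrArg (Sigma.mk i) this)
          have hprod : listProd φ (⟨i, g⟩ :: l).reverse *
              listProd φ ((⟨i, g'⟩ :: l').map invLetter) =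
              listProd φ (l.reverse ++ ⟨i, g * g'⁻¹⟩ :: l'.map invLetter) := by
            simp [invLetter, mul_assoc]
          have hred : IsReducedList φ (l.reverse ++ ⟨i, g * g'⁻¹⟩ :: l'.map invLetter) := by
            constructor
            · have e1 := hl.reverse.chain
              have e2 := hl'.map_invLetter.chain
              simp only [List.reverse_cons, List.map_append, List.map_cons, List.map_nil] at e1 e2 ⊢
              exact List.isChain_split.2 ⟨e1, e2⟩
            · intro p hp
              rcases List.mem_append.1 hp with hp | hp
              · exact hl.tail.reverse.notMem p hp
              · rcases List.mem_cons.1 hp with rfl | hp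
                · exact hne
                · exact hl'.tail.map_invLetter.notMem p hp
          rw [hprod, wordLength_base_mul_listProd_mul_base hred]
          simp [overlap, hab]
          omega
        · rw [← listProd_append, wordLength_base_mul_listProd_mul_base]
          · simp [overlap, hab, hi]
            omega
          · constructor
            · have e1 := hl.reverse.chain
              have e2 := hl'.map_invLetter.chain
              simp only [List.reverse_cons, List.map_append, List.map_cons, List.map_nil,
                List.append_assoc, List.cons_append, List.nil_append] at e1 e2 ⊢
              exact List.isChain_append_cons_cons.2 ⟨e1, hi, e2⟩
            · intro p hp
              rcases List.mem_append.1 hp with hp | hp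
              · exact hl.reverse.notMem p hp
              · exact hl'.map_invLetter.notMem p hp

variable (d) in
/-- The reversed list of letters of the normal form of the inverse. -/
noncomputable def branch (g : PushoutI φ) : List (Σ i, G i) := (normalForm d g⁻¹).toList.reverse

/-- The normal form has its base element on the left. With the normal forms of `g⁻¹` and `h⁻¹`, both
base elements of `g⁻¹ * (h⁻¹)⁻¹` end up outside and the letters face each other. -/
lemma wordLength_inv_mul (g h : PushoutI φ) :
    wordLength d (g⁻¹ * h) + overlap (branch d g) (branch d h) =
      (branch d g).length + (branch d h).length := by
  have hg := eq_base_mul_listProd (d := d) g⁻¹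
  have hh := eq_base_mul_listProd (d := d) h⁻¹
  have hmem : ∀ x : PushoutI φ, ∀ p ∈ branch d x, p.2 ∈ d.set p.1 := fun x p hp =>
    (normalForm d x⁻¹).normalized p.1 p.2 (List.mem_reverse.1 hp)
  have := wordLength_mul_inv (isReducedList_toList (normalForm d g⁻¹)).reverse
    (isReducedList_toList (normalForm d h⁻¹)).reverse (hmem g) (hmem h)
    (normalForm d g⁻¹).head (normalForm d h⁻¹).head⁻¹
  rw [List.reverse_reverse, List.reverse_reverse, map_inv] at this
  have hgh : g⁻¹ * h = g⁻¹ * (h⁻¹)⁻¹ := by rw [inv_inv]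
  rw [hgh, hh]
  conv_lhs => rw [hg]
  rw [mul_inv_rev, ← mul_assoc, mul_assoc (base φ _)]
  exact this

lemma fourPointCondition_wordLength :
    FourPointCondition fun g h : PushoutI φ => (wordLength d (g⁻¹ * h) : ℝ) := by
  intro x y z t
  have hum := fun a b c : PushoutI φ => min_overlap_le (branch d a) (branch d b) (branch d c)
  have hcm := fun a b : PushoutI φ => overlap_comm (branch d a) (branch d b)
  have h1 := wordLength_inv_mul (d := d) x y
  have h2 := wordLength_inv_mul (d := d) z t
  have h3 := wordLength_inv_mul (d := d) x z
  have h4 := wordLength_inv_mul (d := d) y t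
  have h5 := wordLength_inv_mul (d := d) x t
  have h6 := wordLength_inv_mul (d := d) y z
  have u1 := hum x z y
  have u2 := hum x t y
  have u3 := hum z x t
  have u4 := hum z y t
  rw [hcm z y] at u1
  rw [hcm t y] at u2
  rw [hcm z x] at u3
  rw [hcm z y] at u4
  dsimp only
  norm_cast
  omega

end Monoid.PushoutI

open Monoid

/-- A countable group which maps to an amalgamated product does not have property `Fℝ` if its image
contains elements of two different factors which are not in the base group. -/
lemma not_hasPropertyFR_of_pushoutI {Q : Type*} [Group Q] [Countable Q] {ι : Type*}
    {G : ι → Type*} {H : Type*} [∀ i, Group (G i)] [Group H] {φ : ∀ i, H →* G i}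
    (hφ : ∀ i, Function.Injective (φ i)) (ψ : Q →* PushoutI φ) {i j : ι} (hij : i ≠ j)
    {a b : Q} {x : G i} {y : G j} (ha : ψ a = PushoutI.of i x) (hb : ψ b = PushoutI.of j y)
    (hx : x ∉ (φ i).range) (hy : y ∉ (φ j).range) : ¬ HasPropertyFR.{w} Q := by
  obtain ⟨d⟩ := PushoutI.NormalWord.transversal_nonempty φ hφ
  have hone : PushoutI.wordLength d 1 = 0 :=
    PushoutI.wordLength_listProd (.nil φ)
  have hcomm : ∀ g h : PushoutI φ, PushoutI.wordLength d (g⁻¹ * h) =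
      PushoutI.wordLength d (h⁻¹ * g) := by
    intro g h
    have h1 := PushoutI.wordLength_inv_mul (d := d) g h
    have h2 := PushoutI.wordLength_inv_mul (d := d) h g
    rw [PushoutI.overlap_comm] at h2
    omega
  refine not_hasPropertyFR_of_unbounded
    (fun g h => (PushoutI.wordLength d ((ψ g)⁻¹ * ψ h) : ℝ)) ?_ ?_ ?_ ?_ ?_
  · simp [hone]
  · exact fun g h => by rw [hcomm]
  · exact fun g h k l => PushoutI.fourPointCondition_wordLength (ψ g) (ψ h) (ψ k) (ψ l)
  · exact fun g h k => by simp [mul_assoc]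
  · intro r
    obtain ⟨n, hn⟩ := exists_nat_gt r
    -- The alternating words `(x y)ⁿ` are reduced, of length `2n`.
    let l : ℕ → List (Σ i, G i) := fun n => (List.replicate n [⟨i, x⟩, ⟨j, y⟩]).flatten
    have hl : ∀ n, l (n + 1) = ⟨i, x⟩ :: ⟨j, y⟩ :: l n := fun n => by
      simp [l, List.replicate_succ]
    have hred : ∀ n, PushoutI.IsReducedList φ (l n) := by
      intro n
      constructor
      · cases n with
        | zero => simp [l]
        | succ n =>
          induction n with
          | zero => simpa [l] using hij
          | succ n ih =>
            rw [hl] at ih ⊢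
            rw [hl]
            simp only [List.map_cons, List.isChain_cons_cons] at ih ⊢
            exact ⟨hij, hij.symm, ih⟩
      · intro p hp
        simp only [l, List.mem_flatten, List.mem_replicate] at hp
        obtain ⟨m, ⟨-, rfl⟩, hp⟩ := hp
        simp only [List.mem_cons, List.not_mem_nil, or_false] at hp
        rcases hp with rfl | rfl
        · exact hx
        · exact hy
    have hprod : ∀ n, ψ ((a * b) ^ n) = PushoutI.listProd φ (l n) := by
      intro n
      induction n with
      | zero => simp [l]
      | succ n ih =>
        rw [pow_succ', map_mul, map_mul, ih, hl, ha, hb]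
        simp [mul_assoc]
    have hlen : (l n).length = n * 2 := by simp [l]
    refine ⟨(a * b) ^ n, ?_⟩
    rw [map_one, inv_one, one_mul, hprod, PushoutI.wordLength_listProd (hred n), hlen]
    push_cast
    linarith [n.cast_nonneg (α := ℝ)]

open Monoid

/-! ### The amalgam of two subgroups over their intersection. -/

section Amalgam

variable {K : Type*} [Group K] (F : Bool → Subgroup K)

/-- The inclusion of the intersection of two subgroups in these subgroups. -/
abbrev interInclusion (b : Bool) : ↥(⨅ b, F b) →* F b := Subgroup.inclusion (iInf_le F b)

lemma interInclusion_injective (b : Bool) : Function.Injective (interInclusion F b) :=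
  Subgroup.inclusion_injective _

open Classical in
/-- The map from the union of two subgroups to their amalgamated product. -/
noncomputable def toAmalgam (k : K) : PushoutI (interInclusion F) :=
  if h : ∃ b, k ∈ F b then PushoutI.of h.choose ⟨k, h.choose_spec⟩ else 1

variable {F}

/-- The choice of factor is immaterial: an element of both subgroups lies in the amalgamated
intersection. -/
lemma toAmalgam_of_mem {k : K} {b : Bool} (hk : k ∈ F b) :
    toAmalgam F k = PushoutI.of b ⟨k, hk⟩ := by
  have h : ∃ b, k ∈ F b := ⟨b, hk⟩
  rw [toAmalgam, dif_pos h]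
  have key : ∀ c (hc : k ∈ F c), (PushoutI.of c ⟨k, hc⟩ : PushoutI (interInclusion F)) =
      PushoutI.of b ⟨k, hk⟩ := by
    intro c hc
    by_cases hcb : c = b
    · subst hcb
      rfl
    · have hmem : k ∈ ⨅ b, F b := by
        rw [Subgroup.mem_iInf]
        intro e
        cases b <;> cases c <;> cases e <;> first | assumption | exact absurd rfl hcb
      exact (PushoutI.of_apply_eq_base (interInclusion F) c ⟨k, hmem⟩).trans
        (PushoutI.of_apply_eq_base (interInclusion F) b ⟨k, hmem⟩).symm
  exact key _ _

/-- Multiplicativity is claimed inside one factor only. This suffices to transfer relations between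
generators in a common factor. -/
lemma toAmalgam_mul {k l : K} {b : Bool} (hk : k ∈ F b) (hl : l ∈ F b) :
    toAmalgam F (k * l) = toAmalgam F k * toAmalgam F l := by
  rw [toAmalgam_of_mem hk, toAmalgam_of_mem hl, toAmalgam_of_mem ((F b).mul_mem hk hl), ← map_mul]
  rfl

variable (F) in
lemma toAmalgam_one : toAmalgam F 1 = 1 := by
  rw [toAmalgam_of_mem ((F true).one_mem)]
  exact map_one _

lemma toAmalgam_pow {k : K} {b : Bool} (hk : k ∈ F b) (n : ℕ) :
    toAmalgam F (k ^ n) = toAmalgam F k ^ n := by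
  induction n with
  | zero => simp [toAmalgam_one]
  | succ n ih => rw [pow_succ, toAmalgam_mul ((F b).pow_mem hk n) hk, ih, pow_succ]

lemma not_hasPropertyFR_of_toAmalgam {Q : Type*} [Group Q] [Countable Q]
    (ψ : Q →* PushoutI (interInclusion F)) {a b : Q} {x y : K} (ha : ψ a = toAmalgam F x)
    (hb : ψ b = toAmalgam F y) (hx : x ∈ F true) (hx' : x ∉ F false) (hy : y ∈ F false)
    (hy' : y ∉ F true) : ¬ HasPropertyFR.{w} Q := by
  rw [toAmalgam_of_mem hx] at ha
  rw [toAmalgam_of_mem hy] at hb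
  refine not_hasPropertyFR_of_pushoutI (interInclusion_injective F) ψ Bool.noConfusion ha hb ?_ ?_
  · rintro ⟨⟨k, hk⟩, hkx⟩
    obtain rfl : k = x := congrArg Subtype.val hkx
    exact hx' ((Subgroup.mem_iInf.1 hk) false)
  · rintro ⟨⟨k, hk⟩, hky⟩
    obtain rfl : k = y := congrArg Subtype.val hky
    exact hy' ((Subgroup.mem_iInf.1 hk) true)

end Amalgam

/-! ### Graph products over incomplete graphs. -/

/-- `p` lists two distinct non-adjacent vertices; equal or adjacent `i`, `j` cannot include both, so
they avoid one of them. -/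
lemma SimpleGraph.exists_not_adj_of_ne_top {V : Type*} {Γ : SimpleGraph V} (h : Γ ≠ ⊤) :
    ∃ p : Bool → V, p true ≠ p false ∧ ∀ i j, (i = j ∨ Γ.Adj i j) → ∃ b, i ≠ p b ∧ j ≠ p b := by
  have : ∃ v w, v ≠ w ∧ ¬ Γ.Adj v w := by
    by_contra! hcon
    exact h (SimpleGraph.ext (by
      ext v w
      exact ⟨fun hvw => hvw.ne, hcon v w⟩))
  obtain ⟨v, w, hvw, hadj⟩ := this
  refine ⟨fun b => cond b v w, hvw, fun i j hij => ?_⟩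
  by_contra! hcon
  have h1 := hcon true
  have h2 := hcon false
  have hadj' : ¬ Γ.Adj w v := fun h => hadj h.symm
  simp only [cond_true, cond_false] at h1 h2
  by_cases hi : i = v <;> by_cases hi' : i = w <;> grind

instance {V : Type u} [Countable V] (Γ : SimpleGraph V) (G : V → Type v) [∀ i, Group (G i)]
    [∀ i, Countable (G i)] : Countable (GraphProduct Γ G) := by
  have : Countable (FreeMonoid (Σ i, G i)) := inferInstanceAs (Countable (List _))
  have : Countable (CoprodI G) := Quotient.countable
  exact Quotient.countable

lemma GraphProduct.not_hasPropertyFR {V : Type u} [Finite V] (Γ : SimpleGraph V) (G : V → Type v)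
    [∀ i, Group (G i)] [∀ i, Finite (G i)] [∀ i, Nontrivial (G i)] (hΓ : Γ ≠ ⊤) :
    ¬ HasPropertyFR.{w} (GraphProduct Γ G) := by
  classical
  obtain ⟨p, hp, hpair⟩ := SimpleGraph.exists_not_adj_of_ne_top hΓ
  -- Tuples trivial at `p b`: this subgroup contains every vertex group except that of `p b`.
  let F : Bool → Subgroup (∀ i, G i) := fun b => (Pi.evalMonoidHom G (p b)).ker
  have hF : ∀ {i : V} {b : Bool} (g : G i), i ≠ p b → Pi.mulSingle i g ∈ F b := fun g hi =>
    Pi.mulSingle_eq_of_ne hi.symm g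
  let f : ∀ i, G i →* PushoutI (interInclusion F) := fun i =>
    { toFun := fun g => toAmalgam F (Pi.mulSingle i g)
      map_one' := by rw [Pi.mulSingle_one, toAmalgam_one]
      map_mul' := fun g h => by
        obtain ⟨b, hb, -⟩ := hpair i i (.inl rfl)
        rw [Pi.mulSingle_mul, toAmalgam_mul (hF g hb) (hF h hb)] }
  have hf : ∀ i (g : G i), f i g = toAmalgam F (Pi.mulSingle i g) := fun _ _ => rfl
  let ψ : GraphProduct Γ G →* PushoutI (interInclusion F) :=
    QuotientGroup.lift _ (CoprodI.lift f) (by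
      refine Subgroup.normalClosure_le_normal ?_
      rintro _ ⟨i, j, hij, g, h, rfl⟩
      obtain ⟨b, hi, hj⟩ := hpair i j (.inr hij)
      rw [SetLike.mem_coe, MonoidHom.mem_ker]
      simp only [map_mul, map_inv, CoprodI.lift_of]
      rw [mul_inv_eq_one, mul_inv_eq_iff_eq_mul, hf, hf, ← toAmalgam_mul (hF g hi) (hF h hj),
        ← toAmalgam_mul (hF h hj) (hF g hi), (Pi.mulSingle_commute hij.ne g h).eq])
  have hψ : ∀ i (g : G i), ψ (QuotientGroup.mk (CoprodI.of g)) = toAmalgam F (Pi.mulSingle i g) := by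
    intro i g
    change CoprodI.lift f (CoprodI.of g) = _
    rw [CoprodI.lift_of, hf]
  obtain ⟨g, hg⟩ := exists_ne (1 : G (p false))
  obtain ⟨h, hh⟩ := exists_ne (1 : G (p true))
  refine not_hasPropertyFR_of_toAmalgam ψ (hψ _ g) (hψ _ h) (hF g hp.symm) ?_ (hF h hp) ?_
  · intro hmem
    exact hg (by simpa [F] using hmem)
  · intro hmem
    exact hh (by simpa [F] using hmem)

/-! ### The geometric representation and Coxeter groups of incomplete graphs. -/

section Reflections

open Module Polynomial.Chebyshev

/-- Two reflections, the product of which is a rotation by the angle `2π / m`, satisfy the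
relation of the dihedral group of order `2m`. -/
lemma reflection_mul_reflection_pow_eq_one {E : Type*} [AddCommGroup E] [Module ℝ E] {x y : E}
    {f g : Dual ℝ E} (hf : f x = 2) (hg : g y = 2) {m : ℕ} (hm : 3 ≤ m)
    (h : f y * g x = 4 * Real.cos (Real.pi / m) ^ 2) :
    (reflection hf * reflection hg) ^ m = 1 := by
  have hm0 : (m : ℝ) ≠ 0 := by positivity
  have hm3 : (3 : ℝ) ≤ m := by exact_mod_cast hm
  set θ : ℝ := 2 * (Real.pi / m) with hθ
  have ht : 2 * Real.cos θ = f y * g x - 2 := by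
    rw [h, hθ, Real.cos_two_mul]
    ring
  have hmθ : m * θ = 2 * Real.pi := by
    rw [hθ]
    field_simp
  -- Since `m ≥ 3`, the angle `θ = 2π / m` is strictly between `0` and `π`.
  have hsin : Real.sin θ ≠ 0 := by
    refine (Real.sin_pos_of_pos_of_lt_pi ?_ ?_).ne'
    · positivity
    · have := Real.pi_pos
      nlinarith
  have hS : ∀ n : ℤ, (S ℝ n).eval (2 * Real.cos θ) * Real.sin θ = Real.sin ((n + 1) * θ) :=
    fun n => S_two_mul_real_cos θ n
  ext z
  rw [reflection_mul_reflection_pow_apply hf hg m z (2 * Real.cos θ) ht]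
  -- The coefficients of the `m`-th power are Chebyshev values that vanish because `m * θ = 2π`:
  -- `sin (k θ) = 0` for `m = 2k`, and `sin ((k + 1) θ) = -sin (k θ)` for `m = 2k + 1`.
  rcases Nat.even_or_odd' m with ⟨k, hk | hk⟩
  · have e1 : ((m : ℤ) - 2) / 2 = k - 1 := by omega
    have e2 : ((m : ℤ) - 1) / 2 = k - 1 := by omega
    have hz : (S ℝ (k - 1)).eval (2 * Real.cos θ) = 0 := by
      refine (mul_eq_zero.1 ?_).resolve_right hsin
      rw [hS]
      have : ((((k : ℤ) - 1 : ℤ) : ℝ) + 1) * θ = Real.pi := by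
        rw [hk] at hmθ
        push_cast at hmθ ⊢
        linarith
      rw [this, Real.sin_pi]
    simp [e1, e2, hz]
  · have e1 : ((m : ℤ) - 1) / 2 = k := by omega
    have e2 : ((m : ℤ) - 3) / 2 = k - 1 := by omega
    have e3 : (m : ℤ) / 2 = k := by omega
    have e4 : ((m : ℤ) - 2) / 2 = k - 1 := by omega
    have hz : (S ℝ k).eval (2 * Real.cos θ) + (S ℝ (k - 1)).eval (2 * Real.cos θ) = 0 := by
      refine (mul_eq_zero.1 ?_).resolve_right hsin
      rw [add_mul, hS, hS]
      have : (((k : ℤ) : ℝ) + 1) * θ = 2 * Real.pi - ((((k : ℤ) - 1 : ℤ) : ℝ) + 1) * θ := by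
        rw [hk] at hmθ
        push_cast at hmθ ⊢
        linarith
      rw [this, Real.sin_two_pi_sub, neg_add_cancel]
    simp [e1, e2, e3, e4, hz]

/-- The case `m = 2` is separate: there `θ = π` and `sin θ = 0`. -/
lemma reflection_mul_reflection_sq_eq_one {E : Type*} [AddCommGroup E] [Module ℝ E] {x y : E}
    {f g : Dual ℝ E} (hf : f x = 2) (hg : g y = 2) (hfy : f y = 0) (hgx : g x = 0) :
    (reflection hf * reflection hg) ^ 2 = 1 := by
  ext z
  simp only [pow_two, LinearEquiv.mul_apply, reflection_apply, map_sub, map_smul, hf, hg, hfy, hgx,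
    LinearEquiv.coe_one, id_eq]
  module

end Reflections

namespace CoxeterMatrix

variable {V : Type*} (M : CoxeterMatrix V)

/-- The linear form that defines the simple reflection in the geometric representation. -/
noncomputable def coroot (i : V) : Module.Dual ℝ (V →₀ ℝ) :=
  -- For the entry `0`, which encodes `∞`, division by zero gives the angle `0` and the usual value
  -- `-2`.
  Finsupp.linearCombination ℝ fun j => -2 * Real.cos (Real.pi / M i j)

lemma coroot_single (i j : V) :
    M.coroot i (Finsupp.single j 1) = -2 * Real.cos (Real.pi / M i j) := by
  simp [coroot]

lemma coroot_self (i : V) : M.coroot i (Finsupp.single i 1) = 2 := by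
  rw [coroot_single, M.diagonal]
  simp

/-- The simple reflections in the geometric representation. -/
noncomputable def geometricReflection (i : V) : (V →₀ ℝ) ≃ₗ[ℝ] (V →₀ ℝ) :=
  Module.reflection (M.coroot_self i)

lemma geometricReflection_mul_pow (i j : V) :
    (M.geometricReflection i * M.geometricReflection j) ^ M i j = 1 := by
  by_cases hij : i = j
  · subst hij
    rw [M.diagonal, pow_one]
    ext1 z
    exact Module.involutive_reflection (M.coroot_self i) z
  have h1 : M i j ≠ 1 := M.off_diagonal i j hij
  have hs : M j i = M i j := M.symmetric j i
  rcases lt_or_ge (M i j) 3 with hlt | hge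
  · obtain h0 | h2 : M i j = 0 ∨ M i j = 2 := by omega
    · rw [h0, pow_zero]
    · rw [h2]
      refine reflection_mul_reflection_sq_eq_one _ _ ?_ ?_
      · simp [coroot_single, h2]
      · simp [coroot_single, hs, h2]
  · refine reflection_mul_reflection_pow_eq_one _ _ hge ?_
    rw [coroot_single, coroot_single, hs]
    ring

/-- A simple reflection changes only its own coordinate, so it lies in the stabilizer of every other
one. -/
lemma geometricReflection_apply_of_ne {i j : V} (hij : i ≠ j) (z : V →₀ ℝ) :
    M.geometricReflection i z j = z j := by
  simp [geometricReflection, Module.reflection_apply, hij]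

lemma geometricReflection_apply_self (i : V) :
    M.geometricReflection i (Finsupp.single i 1) i = -1 := by
  simp [geometricReflection]

end CoxeterMatrix

/-- The linear automorphisms that preserve a given coordinate. -/
def coordinateStabilizer {V : Type*} (i : V) : Subgroup ((V →₀ ℝ) ≃ₗ[ℝ] (V →₀ ℝ)) where
  carrier := {g | ∀ z, g z i = z i}
  mul_mem' {g h} hg hh z := by rw [LinearEquiv.mul_apply, hg, hh]
  one_mem' z := rfl
  inv_mem' {g} hg z := by
    rw [← hg, ← LinearEquiv.mul_apply, mul_inv_cancel]
    rfl

lemma GraphCoxeterGroup.not_hasPropertyFR {V : Type u} [Finite V] (Γ : SimpleGraph V)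
    (φ : Γ.edgeSet → ℕ) (hφ : ∀ e, 2 ≤ φ e) (hΓ : Γ ≠ ⊤) :
    ¬ HasPropertyFR.{w} (GraphCoxeterGroup Γ φ hφ) := by
  obtain ⟨p, hp, hpair⟩ := SimpleGraph.exists_not_adj_of_ne_top hΓ
  let M := labelledCoxeterMatrix Γ φ hφ
  let F : Bool → Subgroup ((V →₀ ℝ) ≃ₗ[ℝ] (V →₀ ℝ)) := fun b => coordinateStabilizer (p b)
  have hF : ∀ {i : V} {b : Bool}, i ≠ p b → M.geometricReflection i ∈ F b := fun hi z =>
    M.geometricReflection_apply_of_ne hi z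
  have hF' : ∀ b, M.geometricReflection (p b) ∉ F b := fun b hmem => by
    have := hmem (Finsupp.single (p b) 1)
    rw [M.geometricReflection_apply_self, Finsupp.single_eq_same] at this
    norm_num at this
  have hlift : M.IsLiftable fun i => toAmalgam F (M.geometricReflection i) := by
    intro i j
    -- Either both reflections lie in one factor, where the relation of the geometric representation
    -- holds, or the entry is `0` and there is no relation.
    by_cases hij : i = j ∨ Γ.Adj i j
    · obtain ⟨b, hi, hj⟩ := hpair i j hij
      rw [← toAmalgam_mul (hF hi) (hF hj), ← toAmalgam_pow ((F b).mul_mem (hF hi) (hF hj)),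
        M.geometricReflection_mul_pow, toAmalgam_one]
    · have : M i j = 0 := by
        change (labelledCoxeterMatrix Γ φ hφ).M i j = _
        push Not at hij
        simp [labelledCoxeterMatrix, hij.1, hij.2]
      rw [this, pow_zero]
  have : Countable (GraphCoxeterGroup Γ φ hφ) := by
    have : Countable (FreeGroup V) := inferInstanceAs (Countable (Quot _))
    exact Quotient.countable
  have hψ := M.toCoxeterSystem.lift_apply_simple hlift
  exact not_hasPropertyFR_of_toAmalgam _ (hψ (p false)) (hψ (p true)) (hF hp.symm) (hF' false)
    (hF hp) (hF' true)

theorem mainTheorem7 :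
    (∀ (V : Type u) [Finite V] (Γ : SimpleGraph V) (G : V → Type v) [∀ i, Group (G i)]
      [∀ i, Finite (G i)] [∀ i, Nontrivial (G i)],
      HasPropertyFR.{w} (GraphProduct Γ G) ↔ Γ = ⊤) ∧
    (∀ (V : Type u) [Finite V] (Γ : SimpleGraph V) (φ : Γ.edgeSet → ℕ) (hφ : ∀ e, 2 ≤ φ e),
      HasPropertyFR.{w} (GraphCoxeterGroup Γ φ hφ) ↔ Γ = ⊤) := by
  refine ⟨fun V _ Γ G _ _ _ => ⟨fun h => ?_, ?_⟩, fun V _ Γ φ hφ => ⟨fun h => ?_, ?_⟩⟩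
  · by_contra hΓ
    exact GraphProduct.not_hasPropertyFR Γ G hΓ h
  · rintro rfl
    exact GraphProduct.hasPropertyFR G
  · by_contra hΓ
    exact GraphCoxeterGroup.not_hasPropertyFR Γ φ hφ hΓ h
  · rintro rfl
    exact GraphCoxeterGroup.hasPropertyFR φ hφ
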